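/- Let $\mathbb{K}$ be a field, $R=\mathbb{K}[x_1,\ldots,x_n]$ the polynomial ring with its standard grading, and $I\subseteq R$ a monomial ideal with minimal set of monomial generators $G(I)=\{\mathbf{u}_1,\ldots,\mathbf{u}_k\}$. For $1\le i\le k$ let $I_i=(\mathbf{u}_1,\ldots,\mathbf{u}_{i-1},\mathbf{u}_{i+1},\ldots,\mathbf{u}_k)$. For a monomial ideal $J$ let $\beta_{s,t}(J)$ denote its graded Betti numbers, i.e. the $s$-th module in a minimal multigraded free resolution $\cdots\to F_1\to F_0\to J\to 0$ is $F_s\cong\bigoplus_{\mathbf{a}}R[-\mathbf{a}]^{\beta_{s,\mathbf{a}}(J)}$ and $\beta_{s,t}(J)=\sum_{|\mathbf{a}|=t}\beta_{s,\mathbf{a}}(J)$, where $|\mathbf{a}|=a_1+\cdots+a_n$; let $\operatorname{reg}(J)=\max\{t-s : \beta_{s,t}(J)\neq 0\}$ (with $\operatorname{reg}(0)=-\infty$). Let $d\in\mathbb{Z}$ and suppose that $I$ has a $d$-linear resolution, i.e. $\beta_{s,t}(I)=0$ whenever $t-s\neq d$. Then for all $i=1,\ldots,k$: 1. $\operatorname{reg}(I_i)\le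 d+1$; 2. the colon ideal $I_i:\mathbf{u}_i=\{f\in R : f\mathbf{u}_i\in I_i\}$ is generated by a (possibly empty) subset of the variables $x_1,\ldots,x_n$. In particular $I$ is quasi-linear, meaning that (2) holds for every minimal monomial generator of $I$. -/

import Mathlib

open MvPolynomial

namespace MonomialIdeal

/-- The monomial `x^a`. -/
noncomputable abbrev mon (K : Type*) [Field K] {n : ℕ} (a : Fin n →₀ ℕ) :
    MvPolynomial (Fin n) K :=
  monomial a 1

/-- A monomial ideal is an ideal generated by some set of monomials. -/
def IsMonomialIdeal {K : Type*} [Field K] {n : ℕ} (I : Ideal (MvPolynomial (Fin n) K)) : Prop :=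
  ∃ S : Set (Fin n →₀ ℕ), I = Ideal.span (mon K '' S)

/-- `G(I)`, the minimal set of monomial generators of `I`, recorded through exponent vectors:
the monomials of `I` that are minimal with respect to divisibility. -/
def minGens {K : Type*} [Field K] {n : ℕ} (I : Ideal (MvPolynomial (Fin n) K)) :
    Set (Fin n →₀ ℕ) :=
  {a | Minimal (fun b => mon K b ∈ I) a}

/-- The ideal generated by all the elements of `G(I)` except `x^u`. -/
noncomputable def eraseGen {K : Type*} [Field K] {n : ℕ} (I : Ideal (MvPolynomial (Fin n) K))
    (u : Fin n →₀ ℕ) : Ideal (MvPolynomial (Fin n) K) :=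
  Ideal.span (mon K '' (minGens I \ {u}))

/-- `J` is generated by variables, that is, by some subset of the set of variables
(the zero ideal is generated by the empty set). -/
def GeneratedByVariables {K : Type*} [Field K] {n : ℕ} (J : Ideal (MvPolynomial (Fin n) K)) :
    Prop :=
  ∃ A : Set (Fin n), J = Ideal.span ((fun l => (X l : MvPolynomial (Fin n) K)) '' A)

/-- `v` is a multihomogeneous element of multidegree `a` in the free module
`⨁ c, R[-D c]`, whose basis vector number `c` has multidegree `D c`. -/
def IsMultihomogeneous {K : Type*} [Field K] {n : ℕ} {ι : Type*} (D : ι → (Fin n →₀ ℕ))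
    (a : Fin n →₀ ℕ) (v : ι → MvPolynomial (Fin n) K) : Prop :=
  ∀ c, ∀ m ∈ (v c).support, m + D c = a

/-- A minimal multigraded free resolution `⋯ → F₂ → F₁ → F₀ → I → 0` of an ideal `I` of
`R = K[x₁,…,xₙ]`, where `F i = ⨁ b, R[-deg i b]` has a finite basis indexed by
`b : Fin (rank i)`. All the maps preserve the multidegree, the sequence is exact, and minimality
says that the image of `F (i+1)` lies in `𝔪 F i`, where `𝔪 = (x₁,…,xₙ)`.
(As `I` is an ideal of `R`, only shifts in `ℕⁿ` can occur.) -/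
structure MinimalResolution {K : Type*} [Field K] {n : ℕ}
    (I : Ideal (MvPolynomial (Fin n) K)) where
  rank : ℕ → ℕ
  deg : ∀ i, Fin (rank i) → (Fin n →₀ ℕ)
  aug : (Fin (rank 0) → MvPolynomial (Fin n) K) →ₗ[MvPolynomial (Fin n) K]
    MvPolynomial (Fin n) K
  d : ∀ i, (Fin (rank (i + 1)) → MvPolynomial (Fin n) K) →ₗ[MvPolynomial (Fin n) K]
    (Fin (rank i) → MvPolynomial (Fin n) K)
  aug_homogeneous : ∀ b, ∀ m ∈ (aug (Pi.single b 1)).support, m = deg 0 b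
  d_homogeneous : ∀ i b, IsMultihomogeneous (deg i) (deg (i + 1) b) (d i (Pi.single b 1))
  range_aug : LinearMap.range aug = I
  exact_zero : LinearMap.range (d 0) = LinearMap.ker aug
  exact_succ : ∀ i, LinearMap.range (d (i + 1)) = LinearMap.ker (d i)
  minimal : ∀ i v c, constantCoeff (d i v c) = 0

section Existence

variable {K : Type*} [Field K] {n : ℕ} {ι : Type*}

/-- The component of multidegree `a` of an element of `⨁ c, R[-D c]`. -/
noncomputable def component (D : ι → (Fin n →₀ ℕ)) (a : Fin n →₀ ℕ)
    (v : ι → MvPolynomial (Fin n) K) : ι → MvPolynomial (Fin n) K :=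
  fun c => if D c ≤ a then monomial (a - D c) (coeff (a - D c) (v c)) else 0

theorem coeff_component (D : ι → (Fin n →₀ ℕ)) (a : Fin n →₀ ℕ)
    (v : ι → MvPolynomial (Fin n) K) (c : ι) (m : Fin n →₀ ℕ) :
    coeff m (component D a v c) = if m + D c = a then coeff m (v c) else 0 := by
  classical
  unfold component
  by_cases h : D c ≤ a
  · rw [if_pos h, coeff_monomial]
    by_cases h2 : m + D c = a
    · have : a - D c = m := by rw [← h2]; simp
      rw [if_pos h2, this, if_pos rfl]
    · have : a - D c ≠ m := by
        rintro rfl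
        exact h2 (tsub_add_cancel_of_le h)
      rw [if_neg h2, if_neg this]
  · rw [if_neg h, if_neg, coeff_zero]
    rintro rfl
    exact h le_add_self

theorem isMultihomogeneous_component (D : ι → (Fin n →₀ ℕ)) (a : Fin n →₀ ℕ)
    (v : ι → MvPolynomial (Fin n) K) : IsMultihomogeneous D a (component D a v) := by
  intro c m hm
  rw [mem_support_iff, coeff_component] at hm
  by_contra h
  exact hm (if_neg h)

theorem IsMultihomogeneous.coeff_eq_zero {D : ι → (Fin n →₀ ℕ)} {a : Fin n →₀ ℕ}
    {v : ι → MvPolynomial (Fin n) K} (h : IsMultihomogeneous D a v) (c : ι) {m : Fin n →₀ ℕ}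
    (hm : m + D c ≠ a) : coeff m (v c) = 0 := by
  by_contra h2
  exact hm (h c m (mem_support_iff.2 h2))

theorem component_smul {D : ι → (Fin n →₀ ℕ)} {e : Fin n →₀ ℕ}
    {g : ι → MvPolynomial (Fin n) K} (hg : IsMultihomogeneous D e g) (a : Fin n →₀ ℕ)
    (r : MvPolynomial (Fin n) K) :
    component D a (r • g) = (component (fun _ : Unit => e) a (fun _ => r) ()) • g := by
  classical
  ext c m
  rw [coeff_component, Pi.smul_apply, Pi.smul_apply, smul_eq_mul, smul_eq_mul, coeff_mul,
    coeff_mul]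
  split_ifs with h
  · refine Finset.sum_congr rfl fun p hp => ?_
    rw [Finset.HasAntidiagonal.mem_antidiagonal] at hp
    rw [coeff_component]
    by_cases h2 : p.2 + D c = e
    · rw [if_pos]
      rw [← h2, ← add_assoc, hp, h]
    · rw [hg.coeff_eq_zero c h2, mul_zero, mul_zero]
  · symm
    refine Finset.sum_eq_zero fun p hp => ?_
    rw [Finset.HasAntidiagonal.mem_antidiagonal] at hp
    rw [coeff_component]
    by_cases h2 : p.2 + D c = e
    · rw [if_neg, zero_mul]
      intro h3
      rw [← h2, ← add_assoc, hp] at h3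
      exact h h3
    · rw [hg.coeff_eq_zero c h2, mul_zero]

theorem component_sum {κ : Type*} (D : ι → (Fin n →₀ ℕ)) (a : Fin n →₀ ℕ) (s : Finset κ)
    (f : κ → ι → MvPolynomial (Fin n) K) :
    component D a (∑ k ∈ s, f k) = ∑ k ∈ s, component D a (f k) := by
  ext c m
  rw [coeff_component, Finset.sum_apply, Finset.sum_apply, coeff_sum, coeff_sum]
  simp only [coeff_component]
  split_ifs <;> simp

/-- A multigraded submodule of `⨁ c, R[-D c]`. -/
def IsMultigraded (D : ι → (Fin n →₀ ℕ))
    (N : Submodule (MvPolynomial (Fin n) K) (ι → MvPolynomial (Fin n) K)) : Prop :=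
  ∀ v ∈ N, ∀ a, component D a v ∈ N

theorem eq_sum_component [Fintype ι] (D : ι → (Fin n →₀ ℕ))
    (v : ι → MvPolynomial (Fin n) K) :
    ∃ s : Finset (Fin n →₀ ℕ), v = ∑ a ∈ s, component D a v := by
  classical
  refine ⟨Finset.univ.biUnion fun c => (v c).support.image (fun m => m + D c), ?_⟩
  ext c m
  rw [Finset.sum_apply, coeff_sum]
  simp only [coeff_component]
  rw [Finset.sum_ite_eq]
  split_ifs with h
  · rfl
  · by_contra h2
    apply h
    simp only [Finset.mem_biUnion, Finset.mem_univ, true_and, Finset.mem_image]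
    exact ⟨c, m, mem_support_iff.2 h2, rfl⟩

theorem exists_homogeneous_generators [Fintype ι] {D : ι → (Fin n →₀ ℕ)}
    {N : Submodule (MvPolynomial (Fin n) K) (ι → MvPolynomial (Fin n) K)}
    (hN : IsMultigraded D N) :
    ∃ (s : ℕ) (E : Fin s → (Fin n →₀ ℕ)) (g : Fin s → ι → MvPolynomial (Fin n) K),
      (∀ b, IsMultihomogeneous D (E b) (g b)) ∧ Submodule.span _ (Set.range g) = N := by
  classical
  have hspan : Submodule.span (MvPolynomial (Fin n) K)
      {v | v ∈ N ∧ ∃ a, IsMultihomogeneous D a v} = N := by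
    apply le_antisymm
    · exact Submodule.span_le.2 fun v hv => hv.1
    · intro v hv
      obtain ⟨s, hs⟩ := eq_sum_component D v
      rw [hs]
      exact Submodule.sum_mem _ fun a _ => Submodule.subset_span
        ⟨hN v hv a, a, isMultihomogeneous_component D a v⟩
  have hfg : (Submodule.span (MvPolynomial (Fin n) K)
      {v | v ∈ N ∧ ∃ a, IsMultihomogeneous D a v}).FG := IsNoetherian.noetherian _
  obtain ⟨t, ht, hts⟩ := Submodule.fg_span_iff_fg_span_finset_subset _ |>.1 hfg
  have h1 : ∀ b : Fin t.card, ∃ a, IsMultihomogeneous D a (t.equivFin.symm b).1 :=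
    fun b => (ht (t.equivFin.symm b).2).2
  choose E hE using h1
  refine ⟨t.card, E, fun b => (t.equivFin.symm b).1, hE, ?_⟩
  rw [← hspan, hts]
  congr 1
  ext v
  constructor
  · rintro ⟨b, rfl⟩
    exact (t.equivFin.symm b).2
  · intro hv
    exact ⟨t.equivFin ⟨v, hv⟩, by simp⟩

/-- A multigraded submodule of a finite free module has a minimal multigraded presentation. -/
theorem exists_minimal_cover [Fintype ι] {D : ι → (Fin n →₀ ℕ)}
    {N : Submodule (MvPolynomial (Fin n) K) (ι → MvPolynomial (Fin n) K)}
    (hN : IsMultigraded D N) :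
    ∃ (s : ℕ) (E : Fin s → (Fin n →₀ ℕ))
      (φ : (Fin s → MvPolynomial (Fin n) K) →ₗ[MvPolynomial (Fin n) K]
        (ι → MvPolynomial (Fin n) K)),
      (∀ b, IsMultihomogeneous D (E b) (φ (Pi.single b 1))) ∧ LinearMap.range φ = N ∧
      IsMultigraded E (LinearMap.ker φ) ∧
      ∀ v ∈ LinearMap.ker φ, ∀ c, constantCoeff (v c) = 0 := by
  classical
  have hex := exists_homogeneous_generators hN
  obtain ⟨E, g, hg, hgN⟩ := Nat.find_spec hex
  have hmin : ∀ k < Nat.find hex, _ := fun k hk => Nat.find_min hex hk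
  generalize Nat.find hex = s at *
  have hgr : IsMultigraded E (LinearMap.ker (Fintype.linearCombination
      (MvPolynomial (Fin n) K) g)) := by
    intro v hv a
    rw [LinearMap.mem_ker, Fintype.linearCombination_apply] at hv ⊢
    have h1 : ∀ b, component E a v b • g b = component D a (v b • g b) := by
      intro b
      rw [component_smul (hg b)]
      rfl
    simp only [h1]
    rw [← component_sum, hv]
    ext c m
    rw [coeff_component]
    simp
  refine ⟨s, E, Fintype.linearCombination _ g, fun b => ?_, ?_, hgr, ?_⟩
  · rw [Fintype.linearCombination_apply_single, one_smul]
    exact hg b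
  · rw [Fintype.range_linearCombination, hgN]
  · intro v hv b
    by_contra hb
    have hw := hgr v hv (E b)
    set w := component E (E b) v with hwdef
    have hwb : w b = C (constantCoeff (v b)) := by
      rw [hwdef]
      unfold component
      simp [constantCoeff_eq]
    cases s with
    | zero => exact b.elim0
    | succ s =>
      refine hmin s (Nat.lt_succ_self s) ⟨E ∘ b.succAbove, g ∘ b.succAbove,
        fun c => hg _, ?_⟩
      rw [← hgN]
      apply le_antisymm
      · exact Submodule.span_mono (Set.range_comp_subset_range _ _)
      · rw [Submodule.span_le]
        rintro _ ⟨c, rfl⟩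
        rcases Fin.eq_self_or_eq_succAbove b c with rfl | ⟨c', rfl⟩
        · rw [LinearMap.mem_ker, Fintype.linearCombination_apply,
            Fin.sum_univ_succAbove _ c, hwb] at hw
          have h3 : g c = -(C (constantCoeff (v c))⁻¹ : MvPolynomial (Fin n) K) •
              ∑ i, w (c.succAbove i) • g (c.succAbove i) := by
            rw [eq_neg_of_add_eq_zero_right hw, smul_neg, neg_smul, neg_neg, smul_smul, ← C_mul,
              inv_mul_cancel₀ hb, C_1, one_smul]
          rw [h3]
          exact Submodule.smul_mem _ _ (Submodule.sum_mem _ fun i _ =>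
            Submodule.smul_mem _ _ (Submodule.subset_span ⟨i, rfl⟩))
        · exact Submodule.subset_span ⟨c', rfl⟩

theorem IsMonomialIdeal.isMultigraded {I : Ideal (MvPolynomial (Fin n) K)}
    (hI : IsMonomialIdeal I) :
    IsMultigraded (fun _ : Unit => 0)
      (Submodule.comap (LinearMap.proj (R := MvPolynomial (Fin n) K)
        (φ := fun _ : Unit => MvPolynomial (Fin n) K) ()) I) := by
  classical
  obtain ⟨S, rfl⟩ := hI
  intro v hv a
  rw [Submodule.mem_comap, LinearMap.proj_apply] at hv ⊢
  rw [mem_ideal_span_monomial_image] at hv ⊢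
  intro m hm
  rw [mem_support_iff, coeff_component] at hm
  refine hv m (mem_support_iff.2 ?_)
  intro h
  rw [h, ite_self] at hm
  exact hm rfl

/-- A free module `⨁ b, R[-deg b]` of finite rank with a multigraded submodule of it. -/
structure Stage (K : Type*) [Field K] (n : ℕ) where
  rank : ℕ
  deg : Fin rank → (Fin n →₀ ℕ)
  sub : Submodule (MvPolynomial (Fin n) K) (Fin rank → MvPolynomial (Fin n) K)
  graded : IsMultigraded deg sub
  small : ∀ v ∈ sub, ∀ c, constantCoeff (v c) = 0

theorem Stage.exists_next (S : Stage K n) :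
    ∃ (T : Stage K n) (φ : (Fin T.rank → MvPolynomial (Fin n) K) →ₗ[MvPolynomial (Fin n) K]
        (Fin S.rank → MvPolynomial (Fin n) K)),
      (∀ b, IsMultihomogeneous S.deg (T.deg b) (φ (Pi.single b 1))) ∧
      LinearMap.range φ = S.sub ∧ LinearMap.ker φ = T.sub := by
  obtain ⟨s, E, φ, h1, h2, h3, h4⟩ := exists_minimal_cover S.graded
  exact ⟨⟨s, E, LinearMap.ker φ, h3, h4⟩, φ, h1, h2, rfl⟩

/-- Every monomial ideal has a minimal multigraded free resolution. -/
theorem IsMonomialIdeal.nonempty_minimalResolution {I : Ideal (MvPolynomial (Fin n) K)}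
    (hI : IsMonomialIdeal I) : Nonempty (MinimalResolution I) := by
  classical
  obtain ⟨s, E, φ, h1, h2, h3, h4⟩ := exists_minimal_cover hI.isMultigraded
  choose next ψ hψ using (Stage.exists_next (K := K) (n := n))
  let S : ℕ → Stage K n := fun i =>
    Nat.rec (⟨s, E, LinearMap.ker φ, h3, h4⟩ : Stage K n) (fun _ T => next T) i
  refine ⟨{
    rank := fun i => (S i).rank
    deg := fun i => (S i).deg
    aug := (LinearMap.proj (R := MvPolynomial (Fin n) K)
        (φ := fun _ : Unit => MvPolynomial (Fin n) K) ()).comp φ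
    d := fun i => ψ (S i)
    aug_homogeneous := ?_
    d_homogeneous := fun i => (hψ (S i)).1
    range_aug := ?_
    exact_zero := ?_
    exact_succ := fun i => ?_
    minimal := fun i v c => ?_ }⟩
  · intro b m hm
    have := h1 b () m hm
    rwa [add_zero] at this
  · rw [LinearMap.range_comp, h2, Submodule.map_comap_eq_of_surjective]
    exact LinearMap.proj_surjective ()
  · rw [(hψ (S 0)).2.1]
    change LinearMap.ker φ = _
    ext v
    rw [LinearMap.mem_ker, LinearMap.mem_ker, LinearMap.comp_apply, LinearMap.proj_apply]
    exact ⟨fun h => by rw [h]; rfl, fun h => funext fun _ => h⟩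
  · rw [(hψ (S (i + 1))).2.1, (hψ (S i)).2.2]
  · refine (S i).small _ ?_ c
    rw [← (hψ (S i)).2.1]
    exact ⟨v, rfl⟩

end Existence

open Classical in
/-- The multigraded Betti number `β_{i,a}(I)`: the number of summands `R[-a]` of `F i` in a minimal
multigraded free resolution of `I`. Every monomial ideal has such a resolution, and the
number does not depend on the choice of it. -/
noncomputable def multigradedBetti {K : Type*} [Field K] {n : ℕ}
    (I : Ideal (MvPolynomial (Fin n) K)) (i : ℕ) (a : Fin n →₀ ℕ) : ℕ :=
  if h : Nonempty (MinimalResolution I) then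
    Fintype.card {b : Fin (h.some.rank i) // h.some.deg i b = a}
  else 0

/-- The graded Betti number `β_{i,j}(I)`, the sum of `β_{i,a}(I)` over all `a` with `|a| = j`. -/
noncomputable def gradedBetti {K : Type*} [Field K] {n : ℕ}
    (I : Ideal (MvPolynomial (Fin n) K)) (i j : ℕ) : ℕ :=
  ∑ a ∈ Finset.finsuppAntidiag (Finset.univ : Finset (Fin n)) j, multigradedBetti I i a

/-- `I` has a `d`-linear resolution: `β_{i,j}(I) = 0` whenever `j - i ≠ d`. -/
def HasLinearResolution {K : Type*} [Field K] {n : ℕ}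
    (I : Ideal (MvPolynomial (Fin n) K)) (d : ℤ) : Prop :=
  ∀ i j : ℕ, (j : ℤ) - (i : ℤ) ≠ d → gradedBetti I i j = 0

/-- The Castelnuovo–Mumford regularity `reg(I) = max {j - i : β_{i,j}(I) ≠ 0}`, taken in `ℤ` with
`-∞` and `∞` added, so that `reg(0) = -∞` and no boundedness has to be presupposed. -/
noncomputable def regularity {K : Type*} [Field K] {n : ℕ}
    (I : Ideal (MvPolynomial (Fin n) K)) : WithBot (WithTop ℤ) :=
  ⨆ (i : ℕ) (j : ℕ) (_ : gradedBetti I i j ≠ 0),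
    (((((j : ℤ) - (i : ℤ)) : ℤ) : WithTop ℤ) : WithBot (WithTop ℤ))

end MonomialIdeal

open MonomialIdeal

namespace MonomialIdeal

/-! ### Multigraded linear maps between free modules, and lifting through them. -/

section GradedMaps

variable {K : Type*} [Field K] {n : ℕ} {ι κ τ : Type*}

/-! Write `u` for the removed exponent, `L` for `eraseGen I u`, and `J` for the colon ideal `L :
x^u`.

The colon is read off the linear syzygies (`mul_mon_mem_eraseGen_iff`). In a linear resolution of
`I`, let `b` be the basis vector mapping to a scalar multiple of `x^u`. A relation `x^u f ∈ L` is a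
syzygy whose `b`-entry is `f` up to a unit, so `f` is a combination of the `b`-entries of the
generating syzygies. Each of these is zero or a scalar times a variable, and such a variable lies in
`J`.

For the regularity, use `0 → R/J(-u) → R/L → R/I → 0`. Its long exact Tor sequence shows that a
multidegree in step `s` of a minimal resolution of `L` occurs in step `s` for `I`, or is `u` plus
one in step `s + 1` for `R/J` (`deg_mem_or_mem`). The total degree is `s + d` in the first case. In
the second it is `(s + 1) + d`, since iterated mapping cones resolve `R/J` linearly
(`exists_linear_resolution`). Both are at most `s + d + 1`.

Tor itself is replaced by mapping cones: the cone over a comparison map between two resolutions of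
`R/I` resolves zero, hence stays exact modulo `(x₁,…,xₙ)` (`exists_boundary_sub`). -/

theorem IsMultihomogeneous.add {D : ι → (Fin n →₀ ℕ)} {a : Fin n →₀ ℕ}
    {v w : ι → MvPolynomial (Fin n) K} (hv : IsMultihomogeneous D a v)
    (hw : IsMultihomogeneous D a w) : IsMultihomogeneous D a (v + w) := by
  classical
  intro c m hm
  rcases Finset.mem_union.1 (support_add hm) with h | h
  · exact hv c m h
  · exact hw c m h

theorem IsMultihomogeneous.neg {D : ι → (Fin n →₀ ℕ)} {a : Fin n →₀ ℕ}
    {v : ι → MvPolynomial (Fin n) K} (hv : IsMultihomogeneous D a v) :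
    IsMultihomogeneous D a (-v) := by
  intro c m hm
  rw [Pi.neg_apply, support_neg] at hm
  exact hv c m hm

theorem isMultihomogeneous_zero (D : ι → (Fin n →₀ ℕ)) (a : Fin n →₀ ℕ) :
    IsMultihomogeneous D a (0 : ι → MvPolynomial (Fin n) K) := by
  intro c m hm
  simp at hm

theorem IsMultihomogeneous.sum {D : ι → (Fin n →₀ ℕ)} {a : Fin n →₀ ℕ} (s : Finset κ)
    {v : κ → ι → MvPolynomial (Fin n) K} (hv : ∀ k ∈ s, IsMultihomogeneous D a (v k)) :
    IsMultihomogeneous D a (∑ k ∈ s, v k) :=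
  Finset.sum_induction _ (IsMultihomogeneous D a) (fun _ _ => IsMultihomogeneous.add)
    (isMultihomogeneous_zero D a) hv

theorem IsMultihomogeneous.smul {D : ι → (Fin n →₀ ℕ)} {e b : Fin n →₀ ℕ}
    {v : ι → MvPolynomial (Fin n) K} (hv : IsMultihomogeneous D e v)
    {r : MvPolynomial (Fin n) K} (hr : ∀ m ∈ r.support, m + e = b) :
    IsMultihomogeneous D b (r • v) := by
  classical
  intro c m hm
  rw [Pi.smul_apply, smul_eq_mul] at hm
  obtain ⟨p, hp, q, hq, rfl⟩ := Finset.mem_add.1 (support_mul _ _ hm)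
  rw [add_assoc, hv c q hq, hr p hp]

theorem IsMultihomogeneous.deg_eq_of_constantCoeff_ne_zero {D : ι → (Fin n →₀ ℕ)}
    {a : Fin n →₀ ℕ} {v : ι → MvPolynomial (Fin n) K} (hv : IsMultihomogeneous D a v) {c : ι}
    (hc : constantCoeff (v c) ≠ 0) : D c = a := by
  rw [constantCoeff_eq] at hc
  simpa using hv c 0 (mem_support_iff.2 hc)

theorem isMultihomogeneous_single [DecidableEq ι] (D : ι → (Fin n →₀ ℕ)) (b : ι) :
    IsMultihomogeneous D (D b) (Pi.single b (1 : MvPolynomial (Fin n) K)) := by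
  intro c m hm
  rcases eq_or_ne c b with rfl | h
  · rw [Pi.single_eq_same, mem_support_iff, coeff_one] at hm
    have : 0 = m := by by_contra h; simp [h] at hm
    simp [← this]
  · simp [h] at hm

theorem component_eq_self {D : ι → (Fin n →₀ ℕ)} {a : Fin n →₀ ℕ}
    {v : ι → MvPolynomial (Fin n) K} (hv : IsMultihomogeneous D a v) : component D a v = v := by
  ext c m
  rw [coeff_component]
  split_ifs with h
  · rfl
  · exact (hv.coeff_eq_zero c h).symm

/-- A linear map between multigraded free modules that raises multidegrees by `u`. -/
def IsGraded (D : ι → (Fin n →₀ ℕ)) (E : κ → (Fin n →₀ ℕ)) (u : Fin n →₀ ℕ)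
    (f : (ι → MvPolynomial (Fin n) K) →ₗ[MvPolynomial (Fin n) K] (κ → MvPolynomial (Fin n) K)) :
    Prop :=
  ∀ a v, IsMultihomogeneous D a v → IsMultihomogeneous E (a + u) (f v)

theorem linearMap_apply_eq_sum [Fintype ι] [DecidableEq ι]
    (f : (ι → MvPolynomial (Fin n) K) →ₗ[MvPolynomial (Fin n) K] (κ → MvPolynomial (Fin n) K))
    (v : ι → MvPolynomial (Fin n) K) : f v = ∑ b, v b • f (Pi.single b 1) := by
  conv_lhs => rw [pi_eq_sum_univ' v]
  rw [map_sum]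
  refine Finset.sum_congr rfl fun b _ => ?_
  rw [map_smul]

theorem isGraded_of_single [Fintype ι] [DecidableEq ι] {D : ι → (Fin n →₀ ℕ)}
    {E : κ → (Fin n →₀ ℕ)} {u : Fin n →₀ ℕ}
    {f : (ι → MvPolynomial (Fin n) K) →ₗ[MvPolynomial (Fin n) K] (κ → MvPolynomial (Fin n) K)}
    (h : ∀ b, IsMultihomogeneous E (D b + u) (f (Pi.single b 1))) : IsGraded D E u f := by
  intro a v hv
  rw [linearMap_apply_eq_sum]
  exact IsMultihomogeneous.sum _ fun b _ => (h b).smul fun m hm => by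
    rw [← add_assoc, hv b m hm]

theorem IsGraded.map_component [Fintype ι] {D : ι → (Fin n →₀ ℕ)}
    {E : κ → (Fin n →₀ ℕ)} {f : (ι → MvPolynomial (Fin n) K) →ₗ[MvPolynomial (Fin n) K]
      (κ → MvPolynomial (Fin n) K)} (hf : IsGraded D E 0 f) (a : Fin n →₀ ℕ)
    (v : ι → MvPolynomial (Fin n) K) : f (component D a v) = component E a (f v) := by
  classical
  rw [linearMap_apply_eq_sum f v, component_sum, linearMap_apply_eq_sum]
  refine Finset.sum_congr rfl fun b _ => ?_
  have h := hf _ _ (isMultihomogeneous_single D b)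
  rw [add_zero] at h
  rw [component_smul h]
  rfl

theorem IsGraded.comp {D : ι → (Fin n →₀ ℕ)} {E : κ → (Fin n →₀ ℕ)} {H : τ → (Fin n →₀ ℕ)}
    {u : Fin n →₀ ℕ}
    {f : (ι → MvPolynomial (Fin n) K) →ₗ[MvPolynomial (Fin n) K] (κ → MvPolynomial (Fin n) K)}
    {g : (κ → MvPolynomial (Fin n) K) →ₗ[MvPolynomial (Fin n) K] (τ → MvPolynomial (Fin n) K)}
    (hg : IsGraded E H u g) (hf : IsGraded D E 0 f) : IsGraded D H u (g ∘ₗ f) := by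
  intro a v hv
  have := hg _ _ (hf a v hv)
  rwa [add_zero] at this

/-- Multigraded lifting through a multigraded map. -/
theorem exists_graded_lift [Fintype ι] [Fintype τ] {D : ι → (Fin n →₀ ℕ)}
    {E : κ → (Fin n →₀ ℕ)} {H : τ → (Fin n →₀ ℕ)} {u : Fin n →₀ ℕ}
    {f : (ι → MvPolynomial (Fin n) K) →ₗ[MvPolynomial (Fin n) K] (κ → MvPolynomial (Fin n) K)}
    {g : (τ → MvPolynomial (Fin n) K) →ₗ[MvPolynomial (Fin n) K] (κ → MvPolynomial (Fin n) K)}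
    (hf : IsGraded D E u f) (hg : IsGraded H E 0 g) (hfg : ∀ v, ∃ w, g w = f v) :
    ∃ k : (ι → MvPolynomial (Fin n) K) →ₗ[MvPolynomial (Fin n) K] (τ → MvPolynomial (Fin n) K),
      IsGraded D H u k ∧ ∀ v, g (k v) = f v := by
  classical
  choose w hw using hfg
  -- Each basis vector gets the component of an arbitrary preimage in the required multidegree. It
  -- is still a preimage because `g` commutes with taking components.
  let k := Fintype.linearCombination (MvPolynomial (Fin n) K)
    fun b => component H (D b + u) (w (Pi.single b 1))
  have hk : ∀ b, k (Pi.single b 1) = component H (D b + u) (w (Pi.single b 1)) := fun b => by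
    simp only [k]
    rw [Fintype.linearCombination_apply_single, one_smul]
  refine ⟨k, isGraded_of_single fun b => ?_, fun v => ?_⟩
  · rw [hk]
    exact isMultihomogeneous_component _ _ _
  · rw [← LinearMap.comp_apply, linearMap_apply_eq_sum, linearMap_apply_eq_sum f]
    refine Finset.sum_congr rfl fun b _ => ?_
    rw [LinearMap.comp_apply, hk, hg.map_component, hw,
      component_eq_self (hf _ _ (isMultihomogeneous_single D b))]

/-- Linear maps of free modules preserve the vectors with all entries in `(x₁,…,xₙ)`. -/
theorem constantCoeff_map_eq_zero [Fintype ι]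
    (f : (ι → MvPolynomial (Fin n) K) →ₗ[MvPolynomial (Fin n) K] (κ → MvPolynomial (Fin n) K))
    {v : ι → MvPolynomial (Fin n) K} (hv : ∀ b, constantCoeff (v b) = 0) (c : κ) :
    constantCoeff (f v c) = 0 := by
  classical
  rw [linearMap_apply_eq_sum, Finset.sum_apply, map_sum]
  refine Finset.sum_eq_zero fun b _ => ?_
  rw [Pi.smul_apply, smul_eq_mul, map_mul, hv, zero_mul]

/-- A multigraded map sends no basis vector onto one of another multidegree, modulo
`(x₁,…,xₙ)`. -/
theorem IsGraded.constantCoeff_eq_zero [Fintype ι] {D : ι → (Fin n →₀ ℕ)}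
    {E : κ → (Fin n →₀ ℕ)} {u : Fin n →₀ ℕ}
    {f : (ι → MvPolynomial (Fin n) K) →ₗ[MvPolynomial (Fin n) K] (κ → MvPolynomial (Fin n) K)}
    (hf : IsGraded D E u f) {c : κ} (hc : ∀ b, E c ≠ D b + u) (v : ι → MvPolynomial (Fin n) K) :
    constantCoeff (f v c) = 0 := by
  classical
  rw [linearMap_apply_eq_sum, Finset.sum_apply, map_sum]
  refine Finset.sum_eq_zero fun b _ => ?_
  rw [Pi.smul_apply, smul_eq_mul, map_mul]
  by_contra h
  exact hc b ((hf _ _ (isMultihomogeneous_single D b)).deg_eq_of_constantCoeff_ne_zero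
    (right_ne_zero_of_mul h))

/-- Ungraded lifting from projectivity, sufficient for contracting homotopies, whose degrees play no
role. -/
theorem exists_linear_lift [Fintype ι] {M N : Type*} [AddCommGroup M] [AddCommGroup N]
    [Module (MvPolynomial (Fin n) K) M] [Module (MvPolynomial (Fin n) K) N]
    (f : (ι → MvPolynomial (Fin n) K) →ₗ[MvPolynomial (Fin n) K] N)
    (g : M →ₗ[MvPolynomial (Fin n) K] N) (h : ∀ v, ∃ w, g w = f v) :
    ∃ k : (ι → MvPolynomial (Fin n) K) →ₗ[MvPolynomial (Fin n) K] M, ∀ v, g (k v) = f v := by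
  obtain ⟨k, hk⟩ := Module.projective_lifting_property g.rangeRestrict
    (f.codRestrict (LinearMap.range g) h) g.surjective_rangeRestrict
  exact ⟨k, fun v => congrArg Subtype.val (LinearMap.congr_fun hk v)⟩

theorem exists_dependent_sequence {α : ℕ → Type*} (P : ∀ s, α s → Prop)
    (r : ∀ s, α s → α (s + 1) → Prop) (h0 : ∃ a, P 0 a)
    (hs : ∀ s a, P s a → ∃ b, P (s + 1) b ∧ r s a b) :
    ∃ f : ∀ s, α s, ∀ s, P s (f s) ∧ r s (f s) (f (s + 1)) := by
  obtain ⟨a, ha⟩ := h0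
  choose next h1 h2 using hs
  let g : ∀ s, {a : α s // P s a} := fun s =>
    Nat.rec ⟨a, ha⟩ (fun s b => ⟨next s b.1 b.2, h1 s b.1 b.2⟩) s
  exact ⟨fun s => (g s).1, fun s => ⟨(g s).2, h2 s (g s).1 (g s).2⟩⟩

end GradedMaps

end MonomialIdeal

/-! ### Free resolutions of quotients and chain maps lifting multiplication by a monomial. -/

namespace MonomialIdeal

/-- A multigraded free resolution, not necessarily minimal, of the quotient `R ⧸ L`. The
augmentation `aug` maps onto `R`, written as the free module on one generator of multidegree
zero. -/
structure QuotResolution {K : Type*} [Field K] {n : ℕ} (L : Ideal (MvPolynomial (Fin n) K)) where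
  ι : ℕ → Type
  fin : ∀ s, Fintype (ι s)
  deg : ∀ s, ι s → (Fin n →₀ ℕ)
  aug : (ι 0 → MvPolynomial (Fin n) K) →ₗ[MvPolynomial (Fin n) K]
    (Unit → MvPolynomial (Fin n) K)
  d : ∀ s, (ι (s + 1) → MvPolynomial (Fin n) K) →ₗ[MvPolynomial (Fin n) K]
    (ι s → MvPolynomial (Fin n) K)
  graded_aug : IsGraded (deg 0) (fun _ => 0) 0 aug
  graded_d : ∀ s, IsGraded (deg (s + 1)) (deg s) 0 (d s)
  surjective_aug : Function.Surjective aug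
  exact_zero : ∀ v, (∃ w, d 0 w = v) ↔ aug v () ∈ L
  exact_succ : ∀ s v, (∃ w, d (s + 1) w = v) ↔ d s v = 0

attribute [instance] QuotResolution.fin

namespace QuotResolution

variable {K : Type*} [Field K] {n : ℕ} {J L : Ideal (MvPolynomial (Fin n) K)}

theorem d_d (X : QuotResolution L) (s : ℕ) (v) : X.d s (X.d (s + 1) v) = 0 :=
  (X.exact_succ s _).1 ⟨v, rfl⟩

theorem aug_d (X : QuotResolution L) (v) : X.aug (X.d 0 v) () ∈ L :=
  (X.exact_zero _).1 ⟨v, rfl⟩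

/-- Multiplication by `x^u` from `R ⧸ J` to `R ⧸ L` lifts to a multigraded chain map. -/
structure ShiftMap (X : QuotResolution J) (Y : QuotResolution L) (u : Fin n →₀ ℕ) where
  map : ∀ s, (X.ι s → MvPolynomial (Fin n) K) →ₗ[MvPolynomial (Fin n) K]
    (Y.ι s → MvPolynomial (Fin n) K)
  graded : ∀ s, IsGraded (X.deg s) (Y.deg s) u (map s)
  aug_map : ∀ v, Y.aug (map 0 v) = mon K u • X.aug v
  d_map : ∀ s v, Y.d s (map (s + 1) v) = map s (X.d s v)

theorem nonempty_shiftMap (X : QuotResolution J) (Y : QuotResolution L) (u : Fin n →₀ ℕ)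
    (hu : ∀ f ∈ J, mon K u * f ∈ L) : Nonempty (ShiftMap X Y u) := by
  classical
  -- The second clause of the invariant makes the next lift possible. The third carries the
  -- compatibility with the augmentations, which only makes sense at `s = 0`; hence the transport
  -- along `h`.
  have hex := exists_dependent_sequence
    (α := fun s => (X.ι s → MvPolynomial (Fin n) K) →ₗ[MvPolynomial (Fin n) K]
      (Y.ι s → MvPolynomial (Fin n) K))
    (fun s f => IsGraded (X.deg s) (Y.deg s) u f ∧ (∀ v, ∃ w, Y.d s w = f (X.d s v)) ∧
      (s = 0 → ∀ h : s = 0, ∀ v, Y.aug (h ▸ f v) = mon K u • X.aug (h ▸ v)))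
    (fun s f g => ∀ v, Y.d s (g v) = f (X.d s v)) ?_ ?_
  · obtain ⟨f, hf⟩ := hex
    exact ⟨⟨f, fun s => (hf s).1.1, (hf 0).1.2.2 rfl rfl, fun s => (hf s).2⟩⟩
  · have hg : IsGraded (X.deg 0) (fun _ : Unit => (0 : Fin n →₀ ℕ)) u (mon K u • X.aug) := by
      intro a v hv
      rw [LinearMap.smul_apply]
      refine (X.graded_aug a v hv).smul fun m hm => ?_
      rw [Finset.mem_singleton.1 (support_monomial_subset hm), add_zero, add_comm]
    obtain ⟨k, hk, hk2⟩ := exists_graded_lift hg Y.graded_aug fun v => Y.surjective_aug _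
    refine ⟨k, hk, fun v => ?_, fun _ _ v => hk2 v⟩
    rw [Y.exact_zero, hk2]
    exact hu _ (X.aug_d v)
  · rintro s f ⟨hf, hf2, -⟩
    obtain ⟨k, hk, hk2⟩ := exists_graded_lift (hf.comp (X.graded_d s)) (Y.graded_d s) hf2
    refine ⟨k, ⟨hk, fun v => ?_, fun h => absurd h (Nat.succ_ne_zero s)⟩, hk2⟩
    rw [Y.exact_succ, hk2, LinearMap.comp_apply, X.d_d, map_zero]

/-! ### The mapping cone of a shift map. -/

section Cone

variable {X : QuotResolution J} {Y : QuotResolution L} {u : Fin n →₀ ℕ}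

/-- The index types of the mapping cone. -/
def coneIndex (X : QuotResolution J) (Y : QuotResolution L) : ℕ → Type
  | 0 => Y.ι 0
  | s + 1 => Y.ι (s + 1) ⊕ X.ι s

/-- The multidegrees of the mapping cone. -/
noncomputable def coneDeg (X : QuotResolution J) (Y : QuotResolution L) (u : Fin n →₀ ℕ) :
    ∀ s, coneIndex X Y s → (Fin n →₀ ℕ)
  | 0 => Y.deg 0
  | s + 1 => Sum.elim (Y.deg (s + 1)) (fun b => X.deg s b + u)

/-- The first component of the differential of the mapping cone. -/
noncomputable def coneMap (φ : ShiftMap X Y u) (s : ℕ) :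
    (Y.ι (s + 1) ⊕ X.ι s → MvPolynomial (Fin n) K) →ₗ[MvPolynomial (Fin n) K]
      (Y.ι s → MvPolynomial (Fin n) K) :=
  Y.d s ∘ₗ LinearMap.funLeft _ _ Sum.inl + φ.map s ∘ₗ LinearMap.funLeft _ _ Sum.inr

theorem coneMap_apply (φ : ShiftMap X Y u) (s : ℕ)
    (v : Y.ι (s + 1) ⊕ X.ι s → MvPolynomial (Fin n) K) :
    coneMap φ s v = Y.d s (v ∘ Sum.inl) + φ.map s (v ∘ Sum.inr) := rfl

/-- The differential of the mapping cone. -/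
noncomputable def coneD (φ : ShiftMap X Y u) :
    ∀ s, (coneIndex X Y (s + 1) → MvPolynomial (Fin n) K) →ₗ[MvPolynomial (Fin n) K]
      (coneIndex X Y s → MvPolynomial (Fin n) K)
  | 0 => coneMap φ 0
  | s + 1 =>
    (LinearEquiv.sumArrowLequivProdArrow (Y.ι (s + 1)) (X.ι s) (MvPolynomial (Fin n) K)
      (MvPolynomial (Fin n) K)).symm.toLinearMap ∘ₗ
      (coneMap φ (s + 1)).prod (-(X.d s ∘ₗ LinearMap.funLeft _ _ Sum.inr))

theorem coneMap_elim_neg_d (φ : ShiftMap X Y u) (s : ℕ)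
    (w : Y.ι (s + 2) ⊕ X.ι (s + 1) → MvPolynomial (Fin n) K) :
    coneMap φ s (Sum.elim (coneMap φ (s + 1) w) (-X.d s (w ∘ Sum.inr))) = 0 := by
  rw [coneMap_apply, coneMap_apply, Sum.elim_comp_inl, Sum.elim_comp_inr, map_add, Y.d_d,
    φ.d_map, map_neg, zero_add, add_neg_cancel]

theorem exists_coneMap_zero (φ : ShiftMap X Y u) (v : Y.ι 0 → MvPolynomial (Fin n) K) :
    (∃ w, coneMap φ 0 w = v) ↔ Y.aug v () ∈ L ⊔ Ideal.span {mon K u} := by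
  constructor
  · rintro ⟨w, rfl⟩
    rw [coneMap_apply, map_add, Pi.add_apply, φ.aug_map]
    exact Submodule.add_mem_sup (Y.aug_d _)
      (Ideal.mul_mem_right _ _ (Ideal.subset_span rfl))
  · intro hv
    obtain ⟨p, hp, q, hq, hpq⟩ := Submodule.mem_sup.1 hv
    obtain ⟨r, rfl⟩ := Ideal.mem_span_singleton'.1 hq
    obtain ⟨x, hx⟩ := X.surjective_aug fun _ => r
    obtain ⟨y, hy⟩ := (Y.exact_zero (v - φ.map 0 x)).2 (by
      rw [map_sub, φ.aug_map, hx, Pi.sub_apply, ← hpq, Pi.smul_apply, smul_eq_mul,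
        mul_comm r, add_sub_cancel_right]
      exact hp)
    refine ⟨Sum.elim y x, ?_⟩
    rw [coneMap_apply, Sum.elim_comp_inl, Sum.elim_comp_inr, hy, sub_add_cancel]

/-- Exactness of the cone, given that the `X`-part of the cycle is a boundary. That input is left as
a hypothesis because it comes from the colon condition at the bottom and from exactness of `X`
higher up. -/
theorem exists_coneMap_succ (φ : ShiftMap X Y u) (s : ℕ)
    (v : Y.ι (s + 1) ⊕ X.ι s → MvPolynomial (Fin n) K) (hv : coneMap φ s v = 0)
    (hx : ∃ x, X.d s x = -(v ∘ Sum.inr)) :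
    ∃ w, Sum.elim (coneMap φ (s + 1) w) (-X.d s (w ∘ Sum.inr)) = v := by
  obtain ⟨x, hx⟩ := hx
  obtain ⟨y, hy⟩ := (Y.exact_succ s (v ∘ Sum.inl - φ.map (s + 1) x)).2 (by
    rw [map_sub, φ.d_map, hx, map_neg, sub_neg_eq_add, ← coneMap_apply, hv])
  refine ⟨Sum.elim y x, ?_⟩
  rw [coneMap_apply, Sum.elim_comp_inl, Sum.elim_comp_inr, hy, sub_add_cancel, hx, neg_neg]
  exact Sum.elim_comp_inl_inr v

theorem isGraded_coneMap (φ : ShiftMap X Y u) (s : ℕ) :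
    IsGraded (Sum.elim (Y.deg (s + 1)) fun b => X.deg s b + u) (Y.deg s) 0 (coneMap φ s) := by
  classical
  refine isGraded_of_single ?_
  rintro (b | b)
  · have h1 : (Pi.single (Sum.inl b) 1 : Y.ι (s + 1) ⊕ X.ι s → MvPolynomial (Fin n) K) ∘
        Sum.inl = Pi.single b 1 := by ext c : 1; simp [Pi.single_apply]
    have h2 : (Pi.single (Sum.inl b) 1 : Y.ι (s + 1) ⊕ X.ι s → MvPolynomial (Fin n) K) ∘
        Sum.inr = 0 := by ext c : 1; simp
    rw [coneMap_apply, h1, h2, map_zero, add_zero (Y.d s _)]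
    exact Y.graded_d s _ _ (isMultihomogeneous_single _ b)
  · have h1 : (Pi.single (Sum.inr b) 1 : Y.ι (s + 1) ⊕ X.ι s → MvPolynomial (Fin n) K) ∘
        Sum.inr = Pi.single b 1 := by ext c : 1; simp [Pi.single_apply]
    have h2 : (Pi.single (Sum.inr b) 1 : Y.ι (s + 1) ⊕ X.ι s → MvPolynomial (Fin n) K) ∘
        Sum.inl = 0 := by ext c : 1; simp
    rw [coneMap_apply, h1, h2, map_zero, zero_add, add_zero]
    exact φ.graded s _ _ (isMultihomogeneous_single _ b)

theorem isGraded_neg_d_inr (X : QuotResolution J) (Y : QuotResolution L) (u : Fin n →₀ ℕ)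
    (s : ℕ) : IsGraded (Sum.elim (Y.deg (s + 2)) fun b => X.deg (s + 1) b + u)
      (fun b => X.deg s b + u) 0 (-(X.d s ∘ₗ LinearMap.funLeft _ _ Sum.inr)) := by
  classical
  refine isGraded_of_single ?_
  rintro (b | b)
  · have h2 : LinearMap.funLeft (MvPolynomial (Fin n) K) (MvPolynomial (Fin n) K) Sum.inr
        (Pi.single (Sum.inl b) 1 :
        Y.ι (s + 2) ⊕ X.ι (s + 1) → MvPolynomial (Fin n) K) = 0 := by
      ext c : 1; simp [LinearMap.funLeft_apply]
    rw [LinearMap.neg_apply, LinearMap.comp_apply, h2, map_zero, neg_zero]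
    exact isMultihomogeneous_zero _ _
  · have h1 : LinearMap.funLeft (MvPolynomial (Fin n) K) (MvPolynomial (Fin n) K) Sum.inr
        (Pi.single (Sum.inr b) 1 :
        Y.ι (s + 2) ⊕ X.ι (s + 1) → MvPolynomial (Fin n) K) = Pi.single b 1 := by
      ext c : 1; simp [LinearMap.funLeft_apply, Pi.single_apply]
    rw [LinearMap.neg_apply, LinearMap.comp_apply, h1]
    intro c m hm
    have := (X.graded_d s _ _ (isMultihomogeneous_single _ b)).neg c m hm
    rw [← add_assoc, this, add_zero, add_zero]
    rfl

theorem isGraded_coneD (φ : ShiftMap X Y u) (s : ℕ) :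
    IsGraded (coneDeg X Y u (s + 1)) (coneDeg X Y u s) 0 (coneD φ s) := by
  cases s with
  | zero => exact isGraded_coneMap φ 0
  | succ s =>
    rintro a v hv (c | c)
    · exact isGraded_coneMap φ (s + 1) a v hv c
    · exact isGraded_neg_d_inr X Y u s a v hv c

/-- The mapping cone resolves `R ⧸ (L + (x^u))` when `J = L : x^u`. -/
noncomputable def cone (φ : ShiftMap X Y u) (hu : ∀ f, mon K u * f ∈ L → f ∈ J) :
    QuotResolution (L ⊔ Ideal.span {mon K u}) where
  ι := coneIndex X Y
  fin s := match s with
    | 0 => Y.fin 0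
    | s + 1 => @instFintypeSum _ _ (Y.fin (s + 1)) (X.fin s)
  deg := coneDeg X Y u
  aug := Y.aug
  d := coneD φ
  graded_aug := Y.graded_aug
  graded_d := isGraded_coneD φ
  surjective_aug := Y.surjective_aug
  exact_zero v := exists_coneMap_zero φ v
  exact_succ s v := by
    constructor
    · rintro ⟨w, rfl⟩
      cases s with
      | zero => exact coneMap_elim_neg_d φ 0 w
      | succ s =>
        refine (congrArg₂ Sum.elim (coneMap_elim_neg_d φ (s + 1) w)
          (neg_eq_zero.2 ?_)).trans Sum.elim_zero_zero
        exact (map_neg (X.d s) _).trans (neg_eq_zero.2 (X.d_d s _))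
    · intro hv
      cases s with
      | zero =>
        refine exists_coneMap_succ φ 0 v hv ((X.exact_zero _).2 (hu _ ?_))
        -- The cycle condition makes `φ` of the negated `X`-part a boundary of `Y`, so `x^u` times
        -- its augmentation lies in `L`; the colon hypothesis `hu` then applies.
        have h0 : Y.d 0 (v ∘ Sum.inl) + φ.map 0 (v ∘ Sum.inr) = 0 := hv
        have h1 := Y.aug_d (v ∘ Sum.inl)
        rwa [eq_neg_of_add_eq_zero_left h0, ← map_neg, φ.aug_map] at h1
      | succ s =>
        have h0 : -X.d s (v ∘ Sum.inr) = 0 := congrArg (· ∘ Sum.inr) hv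
        refine exists_coneMap_succ φ (s + 1) v (congrArg (· ∘ Sum.inl) hv)
          ((X.exact_succ s _).2 ?_)
        exact (map_neg (X.d s) _).trans h0

end Cone

/-- A free resolution of zero is contractible. Given `h` splitting `d s` on its image, `id - h ∘ d
s` lands in the cycles, so it lifts through `d (s + 1)`; on boundaries it is the identity. -/
theorem exists_homotopy (X : QuotResolution L) (hL : L = ⊤) (s : ℕ) :
    ∃ h : (X.ι s → MvPolynomial (Fin n) K) →ₗ[MvPolynomial (Fin n) K]
      (X.ι (s + 1) → MvPolynomial (Fin n) K), ∀ v, (∃ w, X.d s w = v) → X.d s (h v) = v := by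
  induction s with
  | zero =>
    obtain ⟨h, hh⟩ := exists_linear_lift LinearMap.id (X.d 0) fun v =>
      (X.exact_zero v).2 (hL.ge Submodule.mem_top)
    exact ⟨h, fun v _ => hh v⟩
  | succ s ih =>
    obtain ⟨h, hh⟩ := ih
    obtain ⟨k, hk⟩ := exists_linear_lift (LinearMap.id - h ∘ₗ X.d s) (X.d (s + 1)) fun v => by
      rw [X.exact_succ, LinearMap.sub_apply, LinearMap.id_apply, LinearMap.comp_apply, map_sub,
        hh _ ⟨v, rfl⟩, sub_self]
    refine ⟨k, fun v hv => ?_⟩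
    rw [hk, LinearMap.sub_apply, LinearMap.id_apply, LinearMap.comp_apply,
      (X.exact_succ s v).1 hv, map_zero, sub_zero]

/-- A resolution of the zero module stays exact modulo `(x₁,…,xₙ)`. -/
theorem exists_boundary_sub (X : QuotResolution L) (hL : L = ⊤) {s : ℕ}
    {v : X.ι (s + 1) → MvPolynomial (Fin n) K} (hv : ∀ c, constantCoeff (X.d s v c) = 0) :
    ∃ w, ∀ c, constantCoeff (v c) = constantCoeff (X.d (s + 1) w c) := by
  obtain ⟨h, hh⟩ := X.exists_homotopy hL s
  -- Subtracting `h (d v)` turns `v` into a genuine cycle without changing it modulo `(x₁,…,xₙ)`,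
  -- since the entries of `d v` already lie there.
  obtain ⟨w, hw⟩ := (X.exact_succ s (v - h (X.d s v))).2 (by
    rw [map_sub, hh _ ⟨v, rfl⟩, sub_self])
  refine ⟨w, fun c => ?_⟩
  rw [hw, Pi.sub_apply, map_sub, constantCoeff_map_eq_zero h hv, sub_zero]

end QuotResolution

end MonomialIdeal

/-! ### Linear resolutions for ideals of variables, and comparison of multidegrees. -/

namespace MonomialIdeal

variable {K : Type*} [Field K] {n : ℕ} {L : Ideal (MvPolynomial (Fin n) K)}

namespace MinimalResolution

/-- The index types of the resolution of `R ⧸ L` given by a resolution of `L`. -/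
def quotIndex (F : MinimalResolution L) : ℕ → Type
  | 0 => Unit
  | s + 1 => Fin (F.rank s)

/-- The multidegrees of the resolution of `R ⧸ L` given by a resolution of `L`. -/
noncomputable def quotDeg (F : MinimalResolution L) : ∀ s, F.quotIndex s → (Fin n →₀ ℕ)
  | 0 => fun _ => 0
  | s + 1 => F.deg s

/-- The differential of the resolution of `R ⧸ L` given by a resolution of `L`. -/
noncomputable def quotD (F : MinimalResolution L) :
    ∀ s, (F.quotIndex (s + 1) → MvPolynomial (Fin n) K) →ₗ[MvPolynomial (Fin n) K]
      (F.quotIndex s → MvPolynomial (Fin n) K)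
  | 0 => LinearMap.pi fun _ => F.aug
  | s + 1 => F.d s

/-- A minimal resolution of `L`, continued by `R`, resolves `R ⧸ L`. -/
noncomputable def toQuotResolution (F : MinimalResolution L) : QuotResolution L where
  ι := F.quotIndex
  fin s := match s with
    | 0 => inferInstanceAs (Fintype Unit)
    | s + 1 => inferInstanceAs (Fintype (Fin (F.rank s)))
  deg := F.quotDeg
  aug := LinearMap.id (R := MvPolynomial (Fin n) K) (M := Unit → MvPolynomial (Fin n) K)
  d := F.quotD
  graded_aug a v hv := by
    rw [add_zero]
    exact hv
  graded_d s := by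
    cases s with
    | zero =>
      refine isGraded_of_single (ι := Fin (F.rank 0)) fun b _ m hm => ?_
      exact (add_zero m).trans ((F.aug_homogeneous b m hm).trans (add_zero (F.deg 0 b)).symm)
    | succ s =>
      refine isGraded_of_single (ι := Fin (F.rank (s + 1))) fun b => ?_
      rw [add_zero]
      exact F.d_homogeneous s b
  surjective_aug := Function.surjective_id
  exact_zero v := by
    have h : (∃ w, F.aug w = v ()) ↔ v () ∈ L := SetLike.ext_iff.1 F.range_aug (v ())
    refine Iff.trans ?_ h
    exact ⟨fun ⟨w, hw⟩ => ⟨w, congrFun hw ()⟩, fun ⟨w, hw⟩ => ⟨w, funext fun _ => hw⟩⟩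
  exact_succ s v := by
    cases s with
    | zero =>
      have h : (∃ w, F.d 0 w = v) ↔ F.aug v = 0 := SetLike.ext_iff.1 F.exact_zero v
      exact h.trans ⟨fun h => funext fun _ => h, fun h => congrFun h ()⟩
    | succ s => exact SetLike.ext_iff.1 (F.exact_succ s) v

end MinimalResolution

namespace QuotResolution

/-- The trivial resolution of `R`. -/
noncomputable def bot (K : Type*) [Field K] (n : ℕ) :
    QuotResolution (⊥ : Ideal (MvPolynomial (Fin n) K)) where
  ι := fun s => {_x : Unit // s = 0}
  fin _ := inferInstance
  deg _ _ := 0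
  aug := LinearMap.funLeft _ _ fun _ => ⟨(), rfl⟩
  d _ := 0
  graded_aug a v hv := by
    rw [add_zero]
    exact fun _ => hv _
  graded_d _ _ _ _ := isMultihomogeneous_zero _ _
  surjective_aug w := ⟨fun _ => w (), rfl⟩
  exact_zero v := by
    rw [Ideal.mem_bot]
    exact ⟨fun ⟨w, hw⟩ => by rw [← hw]; rfl, fun h => ⟨0, funext fun _ => h.symm⟩⟩
  exact_succ s v := by
    refine ⟨fun _ => rfl, fun _ => ⟨0, funext fun c => absurd c.2 (Nat.succ_ne_zero s)⟩⟩

end QuotResolution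

/-- A variable outside `A` is a nonzerodivisor modulo the variables in `A`: multiplying a monomial
by it creates no divisibility by these. -/
theorem mem_of_X_mul_mem_span_X {A : Set (Fin n)} {l : Fin n} (hl : l ∉ A)
    {f : MvPolynomial (Fin n) K}
    (hf : X l * f ∈ Ideal.span ((X : Fin n → MvPolynomial (Fin n) K) '' A)) :
    f ∈ Ideal.span ((X : Fin n → MvPolynomial (Fin n) K) '' A) := by
  classical
  rw [mem_ideal_span_X_image] at hf ⊢
  intro m hm
  obtain ⟨i, hi, h⟩ := hf (Finsupp.single l 1 + m) (by
    rw [mem_support_iff, coeff_X_mul]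
    exact mem_support_iff.1 hm)
  refine ⟨i, hi, ?_⟩
  have hil : l ≠ i := fun h => hl (h ▸ hi)
  rwa [Finsupp.add_apply, Finsupp.single_eq_of_ne' hil, zero_add] at h

/-- The quotient by an ideal generated by variables has a linear resolution. -/
theorem exists_linear_resolution (A : Set (Fin n)) :
    ∃ Q : QuotResolution (Ideal.span ((X : Fin n → MvPolynomial (Fin n) K) '' A)),
      ∀ s b, (Q.deg s b).degree = s := by
  induction A, A.toFinite using Set.Finite.induction_on with
  | empty =>
    rw [Set.image_empty, Ideal.span_empty]
    refine ⟨QuotResolution.bot K n, fun s b => ?_⟩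
    obtain ⟨_, rfl⟩ := b
    exact map_zero _
  | @insert l A hl _ ih =>
    obtain ⟨Q, hQ⟩ := ih
    obtain ⟨φ⟩ := Q.nonempty_shiftMap Q (Finsupp.single l 1) fun f hf =>
      Ideal.mul_mem_left _ _ hf
    have h : Ideal.span ((X : Fin n → MvPolynomial (Fin n) K) '' insert l A) =
        Ideal.span (X '' A) ⊔ Ideal.span {mon K (Finsupp.single l 1)} := by
      rw [Set.image_insert_eq, Ideal.span_insert, sup_comm]
      rfl
    rw [h]
    -- As `(A) : x_l = (A)`, source and target of the cone are the same `Q`. The shifted copy moves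
    -- up one homological step and one degree, so linearity persists.
    refine ⟨QuotResolution.cone φ fun f hf => mem_of_X_mul_mem_span_X hl hf, fun s b => ?_⟩
    cases s with
    | zero => exact hQ 0 b
    | succ s =>
      rcases b with b | b
      · exact hQ (s + 1) b
      · refine (map_add Finsupp.degree (Q.deg s b) (Finsupp.single l 1)).trans ?_
        rw [hQ, Finsupp.degree_single]

/-- Every multidegree in a minimal resolution of `L` occurs in any resolution of `L + (x^u)` in
the same homological degree or comes from one of `R ⧸ (L : x^u)` one step further. -/
theorem MinimalResolution.deg_mem_or_mem {J I : Ideal (MvPolynomial (Fin n) K)}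
    {u : Fin n →₀ ℕ} (F : MinimalResolution L) (Q : QuotResolution J) (G : QuotResolution I)
    (hI : I = L ⊔ Ideal.span {mon K u}) (hJ : ∀ f, mon K u * f ∈ L ↔ f ∈ J)
    (hL : ∀ f ∈ L, constantCoeff f = 0) (s : ℕ) (b : Fin (F.rank s)) :
    (∃ c, G.deg (s + 1) c = F.deg s b) ∨ ∃ c, Q.deg (s + 1) c + u = F.deg s b := by
  classical
  by_contra! hne
  obtain ⟨hG, hQ⟩ := hne
  subst hI
  obtain ⟨φ⟩ := Q.nonempty_shiftMap F.toQuotResolution u fun f => (hJ f).2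
  -- `H` and `G` both resolve `R ⧸ I`. The comparison map lifts multiplication by `x^0 = 1`, so its
  -- cone `Z` resolves zero.
  let H := QuotResolution.cone φ fun f => (hJ f).1
  obtain ⟨ψ⟩ := H.nonempty_shiftMap G 0 fun f hf => Ideal.mul_mem_left _ _ hf
  have hone : mon K (0 : Fin n →₀ ℕ) = 1 := rfl
  let Z := QuotResolution.cone ψ fun f hf => by rwa [hone, one_mul] at hf
  have htop : L ⊔ Ideal.span {mon K u} ⊔ Ideal.span {mon K 0} = ⊤ := by
    rw [hone, Ideal.span_singleton_one, sup_top_eq]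
  let x : Fin (F.rank s) ⊕ Q.ι s → MvPolynomial (Fin n) K := Sum.elim (Pi.single b 1) 0
  have hx : IsMultihomogeneous (H.deg (s + 1)) (F.deg s b) x := by
    rintro (c | c)
    · exact isMultihomogeneous_single (F.deg s) b c
    · exact fun m hm => absurd hm (Finset.notMem_empty m)
  -- The basis vector `b` of `F s` seen inside `Z`. It will be a cycle modulo `(x₁,…,xₙ)`, by
  -- minimality of `F` and by `hG`, but not a boundary modulo `(x₁,…,xₙ)`.
  let y : G.ι (s + 2) ⊕ H.ι (s + 1) → MvPolynomial (Fin n) K := Sum.elim 0 x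
  have hHx : ∀ c, constantCoeff (H.d s x c) = 0 := by
    have h : ∀ c, constantCoeff (F.toQuotResolution.d s (Pi.single b 1 : Fin (F.rank s) → _) c) =
        0 := by
      intro c
      -- The step from `F 0` to `R` is not covered by `F.minimal`; there the assumption that `L` has
      -- no constant terms is needed.
      cases s with
      | zero => exact hL _ (F.range_aug.le ⟨_, rfl⟩)
      | succ s => exact F.minimal s _ c
    have h2 : QuotResolution.coneMap φ s x = F.toQuotResolution.d s
        (Pi.single b 1 : Fin (F.rank s) → _) :=
      (congrArg (F.toQuotResolution.d s _ + ·) (map_zero (φ.map s))).trans (add_zero _)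
    cases s with
    | zero => exact fun c => (congrArg (fun v => constantCoeff (v c)) h2).trans (h c)
    | succ s =>
      rintro (c | c)
      · exact (congrArg (fun v => constantCoeff (v c)) h2).trans (h c)
      · have h3 : -Q.d s 0 = 0 := by rw [map_zero, neg_zero]
        exact (congrArg (fun v => constantCoeff (v c)) h3).trans (map_zero _)
  have hy : ∀ c, constantCoeff (Z.d (s + 1) y c) = 0 := by
    rintro (c | c)
    · have h1 : QuotResolution.coneMap ψ (s + 1) y = ψ.map (s + 1) x :=
        (congrArg (· + ψ.map (s + 1) x) (map_zero (G.d (s + 1)))).trans (zero_add _)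
      refine (congrArg (fun v => constantCoeff (v c)) h1).trans ?_
      by_contra h
      have := (ψ.graded (s + 1) _ _ hx).deg_eq_of_constantCoeff_ne_zero h
      rw [add_zero] at this
      exact hG c this
    · refine (congrArg constantCoeff (Pi.neg_apply (H.d s x) c)).trans ?_
      rw [map_neg, hHx, neg_zero]
  obtain ⟨w, hw⟩ := Z.exists_boundary_sub htop hy
  have h1 := hw (Sum.inr (Sum.inl b))
  let w' : Fin (F.rank (s + 1)) ⊕ Q.ι (s + 1) → MvPolynomial (Fin n) K := w ∘ Sum.inr
  -- Only `F` and `φ` contribute to this entry of a boundary. Their constant terms vanish, by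
  -- minimality and by `hQ` respectively, whereas the entry of `y` is `1`.
  have h2 : Z.d (s + 2) w (Sum.inr (Sum.inl b)) =
      -(F.d s (w' ∘ Sum.inl) b + φ.map (s + 1) (w' ∘ Sum.inr) b) := rfl
  have h3 : y (Sum.inr (Sum.inl b)) = 1 := Pi.single_eq_same (M := fun _ => MvPolynomial _ _) b 1
  have h4 : constantCoeff (φ.map (s + 1) (w' ∘ Sum.inr) b) = 0 :=
    (φ.graded (s + 1)).constantCoeff_eq_zero (fun c h => hQ c h.symm) _
  rw [h2, h3, map_neg, map_add, h4, F.minimal, add_zero, neg_zero, map_one] at h1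
  exact one_ne_zero h1

end MonomialIdeal

/-! ### Minimal generators, first syzygies and the colon ideal. -/

namespace MonomialIdeal

variable {K : Type*} [Field K] {n : ℕ} {I : Ideal (MvPolynomial (Fin n) K)}

theorem eq_of_le_of_degree_eq {a b : Fin n →₀ ℕ} (h : a ≤ b) (hd : a.degree = b.degree) :
    a = b := by
  obtain ⟨c, rfl⟩ := exists_add_of_le h
  rw [map_add, left_eq_add, Finsupp.degree_eq_zero_iff] at hd
  rw [hd, add_zero]

theorem exists_eq_single_of_degree_eq_one {m : Fin n →₀ ℕ} (h : m.degree = 1) :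
    ∃ l, m = Finsupp.single l 1 := by
  have h0 : m ≠ 0 := by
    rintro rfl
    simp at h
  obtain ⟨l, hl⟩ := Finsupp.ne_iff.1 h0
  refine ⟨l, (eq_of_le_of_degree_eq ?_ ?_).symm⟩
  · rw [Finsupp.single_le_iff]
    exact Nat.one_le_iff_ne_zero.2 hl
  · rw [h, Finsupp.degree_single]

theorem mon_mem_of_mem_minGens {a : Fin n →₀ ℕ} (ha : a ∈ minGens I) : mon K a ∈ I :=
  ha.1

theorem eq_of_mem_minGens_of_le {a b : Fin n →₀ ℕ} (ha : a ∈ minGens I) (hb : mon K b ∈ I)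
    (hba : b ≤ a) : b = a :=
  hba.antisymm (ha.2 hb hba)

namespace MinimalResolution

/-- The scalar is nonzero because otherwise a basis vector would be a syzygy, and by minimality all
entries of a syzygy have zero constant term. -/
theorem exists_aug_single (F : MinimalResolution I) (b : Fin (F.rank 0)) :
    ∃ k : K, k ≠ 0 ∧ F.aug (Pi.single b 1) = monomial (F.deg 0 b) k := by
  have h : F.aug (Pi.single b 1) =
      monomial (F.deg 0 b) (coeff (F.deg 0 b) (F.aug (Pi.single b 1))) := by
    ext m
    rw [coeff_monomial]
    split_ifs with h
    · rw [h]
    · by_contra hm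
      exact h (F.aug_homogeneous b m (mem_support_iff.2 hm)).symm
  refine ⟨_, fun h0 => ?_, h⟩
  rw [h0, map_zero] at h
  obtain ⟨w, hw⟩ := F.exact_zero.ge (LinearMap.mem_ker.2 h)
  have := F.minimal 0 w b
  rw [hw, Pi.single_eq_same, map_one] at this
  exact one_ne_zero this

theorem aug_eq_sum (F : MinimalResolution I) (v) :
    F.aug v = ∑ b, v b * F.aug (Pi.single b 1) := by
  have h := congrFun (linearMap_apply_eq_sum (LinearMap.pi fun _ : Unit => F.aug) v) ()
  rw [Finset.sum_apply] at h
  exact h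

theorem aug_single (F : MinimalResolution I) (b : Fin (F.rank 0)) (f) :
    F.aug (Pi.single b f) = f * F.aug (Pi.single b 1) := by
  rw [← smul_eq_mul, ← map_smul, ← Pi.single_smul, smul_eq_mul, mul_one]

theorem mon_mem (F : MinimalResolution I) (b : Fin (F.rank 0)) : mon K (F.deg 0 b) ∈ I := by
  obtain ⟨k, hk, h⟩ := F.exists_aug_single b
  refine F.range_aug.le ⟨Pi.single b (C k⁻¹), ?_⟩
  rw [aug_single, h, C_mul_monomial, inv_mul_cancel₀ hk]

theorem exists_deg_le (F : MinimalResolution I) {a : Fin n →₀ ℕ} (ha : mon K a ∈ I) :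
    ∃ b, F.deg 0 b ≤ a := by
  have hI : I ≤ Ideal.span ((fun s => monomial s (1 : K)) '' Set.range (F.deg 0)) := by
    intro f hf
    obtain ⟨v, rfl⟩ := F.range_aug.ge hf
    rw [aug_eq_sum]
    refine Ideal.sum_mem _ fun b _ => Ideal.mul_mem_left _ _ ?_
    obtain ⟨k, -, h⟩ := F.exists_aug_single b
    rw [h, ← mul_one k, ← C_mul_monomial]
    exact Ideal.mul_mem_left _ _ (Ideal.subset_span ⟨_, ⟨b, rfl⟩, rfl⟩)
  obtain ⟨_, ⟨b, rfl⟩, hb⟩ := mem_ideal_span_monomial_image.1 (hI ha) a (by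
    rw [mem_support_iff, coeff_monomial, if_pos rfl]
    exact one_ne_zero)
  exact ⟨b, hb⟩

/-- Two basis vectors over the same monomial would give a syzygy with nonzero constant entries,
against minimality. -/
theorem deg_zero_injective (F : MinimalResolution I) : Function.Injective (F.deg 0) := by
  intro b c hbc
  by_contra hne
  obtain ⟨k, hk, hb⟩ := F.exists_aug_single b
  obtain ⟨l, hl, hc⟩ := F.exists_aug_single c
  obtain ⟨w, hw⟩ := F.exact_zero.ge (LinearMap.mem_ker.2 (show
    F.aug (Pi.single b (C l) - Pi.single c (C k)) = 0 by
      rw [map_sub, aug_single, F.aug_single c, hb, hc, C_mul_monomial, C_mul_monomial, hbc,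
        mul_comm, sub_self]))
  have := F.minimal 0 w b
  rw [hw, Pi.sub_apply, Pi.single_eq_same, Pi.single_eq_of_ne hne, sub_zero,
    constantCoeff_C] at this
  exact hl this

theorem minGens_subset (F : MinimalResolution I) : minGens I ⊆ Set.range (F.deg 0) := by
  intro a ha
  obtain ⟨b, hb⟩ := F.exists_deg_le (mon_mem_of_mem_minGens ha)
  exact ⟨b, eq_of_mem_minGens_of_le ha (F.mon_mem b) hb⟩

theorem minGens_eq (F : MinimalResolution I)
    (hF : ∀ b c, (F.deg 0 b).degree = (F.deg 0 c).degree) :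
    minGens I = Set.range (F.deg 0) := by
  refine F.minGens_subset.antisymm ?_
  rintro _ ⟨b, rfl⟩
  refine ⟨F.mon_mem b, fun a ha hab => ?_⟩
  obtain ⟨c, hc⟩ := F.exists_deg_le ha
  rw [← eq_of_le_of_degree_eq (hc.trans hab) (hF c b)]
  exact hc

/-- Translates membership in the smaller ideal into vanishing of one coordinate, so that the colon
ideal becomes a question about syzygies. -/
theorem mem_eraseGen_iff (F : MinimalResolution I)
    (hF : ∀ b c, (F.deg 0 b).degree = (F.deg 0 c).degree) (b : Fin (F.rank 0))
    (f : MvPolynomial (Fin n) K) :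
    f ∈ eraseGen I (F.deg 0 b) ↔ ∃ v, v b = 0 ∧ F.aug v = f := by
  constructor
  · intro hf
    have h : eraseGen I (F.deg 0 b) ≤
        Submodule.map F.aug (LinearMap.ker (LinearMap.proj (R := MvPolynomial (Fin n) K)
          (φ := fun _ : Fin (F.rank 0) => MvPolynomial (Fin n) K) b)) := by
      refine Ideal.span_le.2 ?_
      rintro _ ⟨a, ⟨ha, hab⟩, rfl⟩
      obtain ⟨c, rfl⟩ := F.minGens_subset ha
      obtain ⟨k, hk, h⟩ := F.exists_aug_single c
      refine ⟨Pi.single c (C k⁻¹), ?_, ?_⟩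
      · refine Pi.single_eq_of_ne ?_ _
        rintro rfl
        exact hab rfl
      · rw [aug_single, h, C_mul_monomial, inv_mul_cancel₀ hk]
    exact h hf
  · rintro ⟨v, hv, rfl⟩
    rw [aug_eq_sum]
    refine Ideal.sum_mem _ fun c _ => ?_
    rcases eq_or_ne c b with rfl | hcb
    · rw [hv, zero_mul]
      exact Ideal.zero_mem _
    · refine Ideal.mul_mem_left _ _ ?_
      obtain ⟨k, -, h⟩ := F.exists_aug_single c
      rw [h, ← mul_one k, ← C_mul_monomial]
      refine Ideal.mul_mem_left _ _ (Ideal.subset_span ⟨F.deg 0 c, ⟨?_, ?_⟩, rfl⟩)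
      · rw [F.minGens_eq hF]
        exact ⟨c, rfl⟩
      · exact fun h => hcb (F.deg_zero_injective h)

theorem eq_eraseGen_sup (F : MinimalResolution I)
    (hF : ∀ b c, (F.deg 0 b).degree = (F.deg 0 c).degree) (b : Fin (F.rank 0)) :
    I = eraseGen I (F.deg 0 b) ⊔ Ideal.span {mon K (F.deg 0 b)} := by
  apply le_antisymm
  · intro f hf
    obtain ⟨v, rfl⟩ := F.range_aug.ge hf
    rw [← sub_add_cancel v (Pi.single b (v b)), map_add]
    refine Submodule.add_mem_sup ((F.mem_eraseGen_iff hF b _).2 ⟨_, ?_, rfl⟩) ?_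
    · rw [Pi.sub_apply, Pi.single_eq_same, sub_self]
    · obtain ⟨k, -, h⟩ := F.exists_aug_single b
      rw [aug_single, h, ← mul_one k, ← C_mul_monomial]
      exact Ideal.mul_mem_left _ _ (Ideal.mul_mem_left _ _ (Ideal.subset_span rfl))
  · refine sup_le (Ideal.span_le.2 ?_) (Ideal.span_le.2 ?_)
    · rintro _ ⟨a, ha, rfl⟩
      exact mon_mem_of_mem_minGens ha.1
    · rintro _ rfl
      exact F.mon_mem b

/-- The colon ideal consists of the `b`-entries of first syzygies. The degree hypothesis `hF1` makes
those entries linear, and multihomogeneity leaves at most one term in each. -/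
theorem mul_mon_mem_eraseGen_iff (F : MinimalResolution I)
    (hF : ∀ b c, (F.deg 0 b).degree = (F.deg 0 c).degree)
    (hF1 : ∀ b c, (F.deg 1 c).degree = (F.deg 0 b).degree + 1) (b : Fin (F.rank 0))
    (f : MvPolynomial (Fin n) K) :
    mon K (F.deg 0 b) * f ∈ eraseGen I (F.deg 0 b) ↔
      f ∈ Ideal.span ((X : Fin n → MvPolynomial (Fin n) K) ''
        {l | mon K (F.deg 0 b) * X l ∈ eraseGen I (F.deg 0 b)}) := by
  obtain ⟨k, hk, hkb⟩ := F.exists_aug_single b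
  constructor
  · intro hf
    obtain ⟨g, hg, hgf⟩ := (F.mem_eraseGen_iff hF b _).1 hf
    obtain ⟨w, hw⟩ := F.exact_zero.ge (LinearMap.mem_ker.2 (show
      F.aug (Pi.single b (C k⁻¹ * f) - g) = 0 by
        rw [map_sub, aug_single, hkb, hgf, mul_right_comm, C_mul_monomial, inv_mul_cancel₀ hk,
          sub_self]))
    have hfw : f = C k * F.d 0 w b := by
      rw [hw, Pi.sub_apply, Pi.single_eq_same, hg, sub_zero, ← mul_assoc, ← C_mul,
        mul_inv_cancel₀ hk, C_1, one_mul]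
    rw [hfw, linearMap_apply_eq_sum, Finset.sum_apply]
    refine Ideal.mul_mem_left _ _ (Ideal.sum_mem _ fun c _ => Ideal.mul_mem_left _ _ ?_)
    set p := F.d 0 (Pi.single c 1) with hp
    rw [mem_ideal_span_X_image]
    intro m hm
    have hmdeg := F.d_homogeneous 0 c b m hm
    obtain ⟨l, rfl⟩ := exists_eq_single_of_degree_eq_one (m := m) (by
      have h1 := hF1 b c
      rw [← hmdeg, map_add, add_comm] at h1
      exact add_left_cancel h1)
    refine ⟨l, ?_, by simp⟩
    -- The multidegrees of the syzygy and of `b` determine the exponent, so no second term can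
    -- occur.
    have hpb : p b = monomial (Finsupp.single l 1) (coeff (Finsupp.single l 1) (p b)) := by
      ext m'
      rw [coeff_monomial]
      split_ifs with h
      · rw [h]
      · by_contra hm'
        exact h (add_right_cancel
          (hmdeg.trans (F.d_homogeneous 0 c b m' (mem_support_iff.2 hm')).symm))
    set r := coeff (Finsupp.single l 1) (p b)
    have hr : r ≠ 0 := mem_support_iff.1 hm
    have h0 : F.aug p = 0 := F.exact_zero.le ⟨_, rfl⟩
    -- Since `p` is a syzygy, its `b`-term has the same image as a vector with zero `b`-entry.
    -- Dividing by `r * k` then shows that `x_l` is in the colon.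
    have h1 : F.aug (Pi.single b (p b) - p) ∈ eraseGen I (F.deg 0 b) :=
      (F.mem_eraseGen_iff hF b _).2 ⟨_, by rw [Pi.sub_apply, Pi.single_eq_same, sub_self], rfl⟩
    rw [map_sub, h0, sub_zero, aug_single, hpb, hkb, monomial_mul] at h1
    have h2 := Ideal.mul_mem_left _ (C (r * k)⁻¹) h1
    rw [C_mul_monomial, inv_mul_cancel₀ (mul_ne_zero hr hk)] at h2
    change mon K (F.deg 0 b) * monomial (Finsupp.single l 1) 1 ∈
      eraseGen I (F.deg 0 b)
    rwa [monomial_mul, mul_one, add_comm]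
  · intro hf
    have h : Ideal.span ((X : Fin n → MvPolynomial (Fin n) K) ''
        {l | mon K (F.deg 0 b) * X l ∈ eraseGen I (F.deg 0 b)}) ≤
        (eraseGen I (F.deg 0 b)).colon {mon K (F.deg 0 b)} := by
      refine Ideal.span_le.2 ?_
      rintro _ ⟨l, hl, rfl⟩
      refine Submodule.mem_colon_singleton.2 ?_
      rw [smul_eq_mul, mul_comm]
      exact hl
    rw [mul_comm]
    exact Submodule.mem_colon_singleton.1 (h hf)

end MinimalResolution

/-- The resolution chosen in `multigradedBetti` works: each of its basis vectors is counted by a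
Betti number. As `deg_mem_or_mem` allows any minimal resolution of the smaller ideal, independence
of the choice is never needed. -/
theorem HasLinearResolution.exists_minimalResolution (hI : IsMonomialIdeal I) {d : ℤ}
    (hlin : HasLinearResolution I d) :
    ∃ G : MinimalResolution I, ∀ i b, ((G.deg i b).degree : ℤ) - i = d := by
  have hne := hI.nonempty_minimalResolution
  refine ⟨hne.some, fun i b => ?_⟩
  by_contra h
  have h1 := hlin i _ h
  unfold gradedBetti at h1
  rw [Finset.sum_eq_zero_iff] at h1
  have h2 := h1 (hne.some.deg i b) (by
    rw [Finset.mem_finsuppAntidiag]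
    exact ⟨(Finsupp.degree_eq_sum _).symm, Finset.subset_univ _⟩)
  unfold multigradedBetti at h2
  rw [dif_pos hne, Fintype.card_eq_zero_iff] at h2
  exact h2.false ⟨b, rfl⟩

theorem exists_deg_of_gradedBetti_ne_zero {i j : ℕ} (h : gradedBetti I i j ≠ 0) :
    ∃ (F : MinimalResolution I) (b : Fin (F.rank i)), (F.deg i b).degree = j := by
  obtain ⟨a, ha, hne⟩ := Finset.exists_ne_zero_of_sum_ne_zero h
  rw [Finset.mem_finsuppAntidiag] at ha
  unfold multigradedBetti at hne
  split_ifs at hne with hF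
  · obtain ⟨b, hb⟩ := Fintype.card_pos_iff.1 (Nat.pos_of_ne_zero hne)
    exact ⟨hF.some, b, by rw [hb, Finsupp.degree_eq_sum, ha.1]⟩
  · exact absurd rfl hne

/-- If `1` were a minimal generator, it would divide `x^u` and hence be the generator removed. -/
theorem constantCoeff_eq_zero_of_mem_eraseGen {u : Fin n →₀ ℕ} (hu : u ∈ minGens I)
    {f : MvPolynomial (Fin n) K} (hf : f ∈ eraseGen I u) : constantCoeff f = 0 := by
  have h : eraseGen I u ≤ RingHom.ker constantCoeff := by
    refine Ideal.span_le.2 ?_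
    rintro _ ⟨a, ⟨ha, hau⟩, rfl⟩
    have h0 : a ≠ 0 := by
      rintro rfl
      exact hau (eq_of_mem_minGens_of_le hu (mon_mem_of_mem_minGens ha) zero_le)
    rw [SetLike.mem_coe, RingHom.mem_ker, constantCoeff_monomial, if_neg h0]
  exact h hf

end MonomialIdeal

theorem theorem2p3 {K : Type*} [Field K] {n : ℕ} (I : Ideal (MvPolynomial (Fin n) K))
    (hI : IsMonomialIdeal I) (d : ℤ) (hlin : HasLinearResolution I d) :
    ∀ u ∈ minGens I,
      regularity (eraseGen I u) ≤ (((d + 1 : ℤ) : WithTop ℤ) : WithBot (WithTop ℤ)) ∧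
      GeneratedByVariables
        ((eraseGen I u).colon (Ideal.span {mon K u} : Ideal (MvPolynomial (Fin n) K))) := by
  intro u hu
  obtain ⟨G, hG⟩ := hlin.exists_minimalResolution hI
  obtain ⟨b, rfl⟩ := G.minGens_subset hu
  have h0 : ∀ b c, (G.deg 0 b).degree = (G.deg 0 c).degree := fun b c => by
    have h1 := hG 0 b
    have h2 := hG 0 c
    omega
  have hcolon := G.mul_mon_mem_eraseGen_iff h0 (fun b c => by
    have h1 := hG 0 b
    have h2 := hG 1 c
    push_cast at h1 h2
    omega) b
  refine ⟨?_, {l | mon K (G.deg 0 b) * X l ∈ eraseGen I (G.deg 0 b)}, ?_⟩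
  · refine iSup_le fun i => iSup_le fun j => iSup_le fun hij => ?_
    rw [WithBot.coe_le_coe, WithTop.coe_le_coe]
    obtain ⟨F, c, rfl⟩ := exists_deg_of_gradedBetti_ne_zero hij
    obtain ⟨Q, hQ⟩ := exists_linear_resolution (K := K)
      {l | mon K (G.deg 0 b) * X l ∈ eraseGen I (G.deg 0 b)}
    -- Step `i + 1` of the resolution of `R ⧸ I` is step `i` of `G`, so the first case gives `j - i
    -- = d`. In the second, `Q` contributes `i + 1` and the shift contributes `d`.
    rcases F.deg_mem_or_mem Q G.toQuotResolution (G.eq_eraseGen_sup h0 b) hcolon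
      (fun f hf => constantCoeff_eq_zero_of_mem_eraseGen hu hf) i c with ⟨e, he⟩ | ⟨e, he⟩
    · have h1 := hG i e
      have h2 : G.deg i e = F.deg i c := he
      rw [h2] at h1
      omega
    · have h1 := hG 0 b
      rw [← he, map_add, hQ]
      push_cast at h1 ⊢
      omega
  · ext f
    rw [Ideal.mem_colon_span_singleton, mul_comm]
    exact hcolon f
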